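/- Let $L>0$, $\varepsilon\in(0,1)$, $f(u)=\varepsilon u-u^3$, $F(u)=\frac14u^4-\frac{\varepsilon}{2}u^2$ (so $f=-F'$). For an even integer $M\ge 2$ let $h=L/M$ and consider real $L$-periodic grid functions on the uniform $M\times M$ grid of $(0,L)^2$, with $\langle v,w\rangle=h^2\sum_{x_h}v_hw_h$ and $\|v\|=\sqrt{\langle v,v\rangle}$. Let $\Delta_h$ be the Fourier pseudo-spectral Laplacian, i.e. the operator multiplying the discrete Fourier coefficient at the wave number $(k_1,k_2)$, $-M/2\le k_1,k_2\le M/2-1$, by $-\nu^2(k_1^2+k_2^2)$, $\nu=2\pi/L$. Put $$E[v]=\tfrac12\langle v,(I+\Delta_h)^2v\rangle+\langle F(v),1\rangle,\qquad L_\kappa=(I+\Delta_h)^2+\kappa I,\qquad f_\kappa(u)=\kappa u+f(u).$$ Let $M_h=-I$ (Swift–Hohenberg equation) or $M_h=\Delta_h$ (phase field crystal equation); in the latter case $M_h^{-1}$ is the inverse Laplacian on mean-zero grid functions. An $s$-stage Runge–Kutta method (for instance an IERK, EERK or CIFRK method) is given in the unified differential form by lower-triangular real matrices $D(z)=(d_{ij}(z))_{i,j=1}^s$,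 $z\le 0$: with $u^{n,1}=\phi^{n-1}$ and $\phi^n=u^{n,s+1}$, for $n\ge1$ and $1\le i\le s$, $$\frac1\tau\sum_{j=1}^i d_{ij}(\tau M_hL_\kappa)\,\delta u^{n,j+1}=M_h\Big[L_\kappa\tfrac{u^{n,i+1}+u^{n,i}}2-f_\kappa(u^{n,i})\Big],\qquad \delta u^{n,j+1}=u^{n,j+1}-u^{n,j},$$ where $d_{ij}(\tau M_hL_\kappa)$ acts on each Fourier mode by the value of $d_{ij}$ at the corresponding eigenvalue of $\tau M_hL_\kappa$. Assume that for every $z<0$ the matrix $D(z)$ is positive definite (i.e. its symmetric part $\frac12(D(z)+D(z)^T)$ is) and that the eigenvalues of this symmetric part are bounded below by a constant $\lambda_{\mathrm{es}}>0$ independent of $z$; when $M_h=\Delta_h$, for which $0$ is an eigenvalue of $\tau M_hL_\kappa$, assume also that $D(0)$ is invertible (this holds, for example, if $D$ is continuous from the left at $0$). Then for every $E_0\in\mathbb R$ there is a constant $C_f>0$, depending only on $L$, $\varepsilon$ and $E_0$, and for all $s$, $\lambda_{\mathrm{es}}>0$ and $\kappa\ge C_f$ there is a constant $\tau_0>0$,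 depending only on $L,\varepsilon,E_0,s,\lambda_{\mathrm{es}},\kappa$ (in particular, neither constant depends on $h$ or $\tau$), such that for every such method, every grid, every $0<\tau\le\tau_0$ and every solution of the scheme with $E[\phi^0]\le E_0$ the following hold for all $n\ge1$. The stage-wise original energy dissipation law $$E[u^{n,k+1}]-E[u^{n,1}]\le\frac1\tau\sum_{i=1}^k\Big\langle M_h^{-1}\delta u^{n,i+1},\sum_{j=1}^i d_{ij}(\tau M_hL_\kappa)\,\delta u^{n,j+1}\Big\rangle\le0,\qquad 1\le k\le s,$$ (where, if $M_h=\Delta_h$, all $\delta u^{n,i+1}$ have mean zero), and the global-in-time bound $$\|(I+\Delta_h)u^{n,i}\|+\|u^{n,i}\|\le\sqrt{4E[\phi^0]+(1+\varepsilon)^2L^2},\qquad 1\le i\le s+1.$$ -/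

import Mathlib

open Finset

noncomputable section

namespace PFC

/-- Periodic grid functions on the uniform `M × M` grid of mesh size `h = L / M`.
The index `(m, n)` stands for the point `(m h, n h)`; by periodicity the indices
`0, …, M - 1` in each direction describe all the values. -/
abbrev GridFn (M : ℕ) : Type := Fin M × Fin M → ℝ

/-- The mesh size `h = L / M`. -/
def mesh (L : ℝ) (M : ℕ) : ℝ := L / M

/-- The base frequency `ν = 2 π / L`. -/
def freq (L : ℝ) : ℝ := 2 * Real.pi / L

/-- The wave numbers `(k₁, k₂)` with `-M/2 ≤ k₁, k₂ ≤ M/2 - 1`. -/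
def modes (M : ℕ) : Finset (ℤ × ℤ) :=
  Ico (-((M : ℤ) / 2)) ((M : ℤ) / 2) ×ˢ Ico (-((M : ℤ) / 2)) ((M : ℤ) / 2)

/-- The exponential `exp (i ν (k₁ x + k₂ y))` at the grid point with index `p`. -/
def expo (L : ℝ) (M : ℕ) (k : ℤ × ℤ) (p : Fin M × Fin M) : ℂ :=
  Complex.exp (Complex.I *
    (freq L * (k.1 * ((p.1 : ℕ) * mesh L M) + k.2 * ((p.2 : ℕ) * mesh L M)) : ℝ))

/-- The pseudo-spectral (discrete Fourier) coefficient of `v` at the wave number `k`. -/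
def coeff (L : ℝ) (M : ℕ) (v : GridFn M) (k : ℤ × ℤ) : ℂ :=
  (1 / (M : ℂ) ^ 2) * ∑ p, (v p : ℂ) * (starRingEnd ℂ) (expo L M k p)

/-- The operator on grid functions that is diagonal in the discrete Fourier basis and multiplies
the coefficient at the wave number `k` by `σ k`. It is used only with symbols that are functions of
`k₁ ^ 2` and `k₂ ^ 2`, for which the sum is already real on the grid. -/
def fourierMult (L : ℝ) (M : ℕ) (σ : ℤ × ℤ → ℝ) (v : GridFn M) : GridFn M :=
  fun p => (∑ k ∈ modes M, (σ k : ℂ) * coeff L M v k * expo L M k p).re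

/-- The eigenvalue `-ν² (k₁² + k₂²)` of the discrete Laplacian at the wave number `k`. -/
def lapSymbol (L : ℝ) (k : ℤ × ℤ) : ℝ :=
  -(freq L * k.1) ^ 2 - (freq L * k.2) ^ 2

/-- The Fourier pseudo-spectral Laplacian `Δ_h`. -/
def lap (L : ℝ) (M : ℕ) (v : GridFn M) : GridFn M := fourierMult L M (lapSymbol L) v

/-- The operator `I + Δ_h`. -/
def onePlusLap (L : ℝ) (M : ℕ) (v : GridFn M) : GridFn M := v + lap L M v

/-- The stabilized operator `L_κ = (I + Δ_h)² + κ I`. -/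
def stabOp (L κ : ℝ) (M : ℕ) (v : GridFn M) : GridFn M :=
  onePlusLap L M (onePlusLap L M v) + κ • v

/-- The eigenvalue of `L_κ` at the wave number `k`. -/
def stabSymbol (L κ : ℝ) (k : ℤ × ℤ) : ℝ := (1 + lapSymbol L k) ^ 2 + κ

/-- The discrete inner product `⟨v, w⟩ = h² ∑ v_h w_h`. -/
def ip (L : ℝ) (M : ℕ) (v w : GridFn M) : ℝ := mesh L M ^ 2 * ∑ p, v p * w p

/-- The discrete `L²` norm. -/
def l2norm (L : ℝ) (M : ℕ) (v : GridFn M) : ℝ := Real.sqrt (ip L M v v)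

/-- The nonlinear bulk `f(u) = ε u - u³`. -/
def bulk (ε x : ℝ) : ℝ := ε * x - x ^ 3

/-- The stabilized nonlinear bulk `f_κ(u) = κ u + f(u)`. -/
def stabBulk (ε κ x : ℝ) : ℝ := κ * x + bulk ε x

/-- The double-well potential `F(u) = u⁴ / 4 - ε u² / 2`. -/
def potential (ε x : ℝ) : ℝ := x ^ 4 / 4 - ε / 2 * x ^ 2

theorem bulk_contDiff (ε : ℝ) : ContDiff ℝ 1 (bulk ε) := by
  unfold bulk; fun_prop

theorem hasDerivAt_potential (ε x : ℝ) : HasDerivAt (potential ε) (-bulk ε x) x := by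
  have h := ((hasDerivAt_pow 4 x).div_const 4).sub ((hasDerivAt_pow 2 x).const_mul (ε / 2))
  have e : -bulk ε x = ((4 : ℕ) : ℝ) * x ^ (4 - 1) / 4 - ε / 2 * (((2 : ℕ) : ℝ) * x ^ (2 - 1)) := by
    unfold bulk; norm_num; ring
  rw [e]; exact h

/-- The discrete Swift-Hohenberg energy `E[v] = ½ ⟨v, (I + Δ_h)² v⟩ + ⟨F(v), 1⟩`. -/
def energy (L ε : ℝ) (M : ℕ) (v : GridFn M) : ℝ :=
  1 / 2 * ip L M v (onePlusLap L M (onePlusLap L M v)) + ip L M (fun p => potential ε (v p)) 1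

/-- The two models: Swift-Hohenberg (`M_h = -I`) and phase field crystal (`M_h = Δ_h`). -/
inductive Model
  | swiftHohenberg
  | phaseFieldCrystal

/-- The mobility operator `M_h`. -/
def mobility (L : ℝ) (M : ℕ) : Model → GridFn M → GridFn M
  | .swiftHohenberg, v => -v
  | .phaseFieldCrystal, v => lap L M v

/-- The eigenvalue of `M_h` at the wave number `k`. -/
def mobilitySymbol (L : ℝ) : Model → ℤ × ℤ → ℝ
  | .swiftHohenberg, _ => -1
  | .phaseFieldCrystal, k => lapSymbol L k

/-- The inverse mobility `M_h⁻¹`. For `M_h = Δ_h` this is the inverse Laplacian on grid functions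
of mean zero: the sum is over the nonzero wave numbers. -/
def mobilityInv (L : ℝ) (M : ℕ) : Model → GridFn M → GridFn M
  | .swiftHohenberg, v => -v
  | .phaseFieldCrystal, v => fourierMult L M (fun k => if k = 0 then 0 else (lapSymbol L k)⁻¹) v

/-- The matrix function `g(τ M_h L_κ)`: `M_h` and `L_κ` are diagonal in the discrete Fourier basis,
so it multiplies the coefficient at `k` by the value of `g` at the eigenvalue of `τ M_h L_κ`. -/
def opFun (L κ τ : ℝ) (M : ℕ) (md : Model) (g : ℝ → ℝ) (v : GridFn M) : GridFn M :=
  fourierMult L M (fun k => g (τ * (mobilitySymbol L md k * stabSymbol L κ k))) v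

/-- The symmetric part `S(A) = (A + Aᵀ) / 2` of a square matrix. -/
def symmPart {s : ℕ} (A : Matrix (Fin s) (Fin s) ℝ) : Matrix (Fin s) (Fin s) ℝ :=
  (1 / 2 : ℝ) • (A + A.transpose)

/-- `D(z)` is lower triangular for every `z ≤ 0`. -/
def IsLowerTriangular {s : ℕ} (D : ℝ → Matrix (Fin s) (Fin s) ℝ) : Prop :=
  ∀ z ≤ 0, ∀ i j, i < j → D z i j = 0

/-- For every `z < 0` the matrix `D(z)` is positive definite (that is, its symmetric part is), and
no eigenvalue of its symmetric part is smaller than `lam`. -/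
def UniformlyPosDef {s : ℕ} (D : ℝ → Matrix (Fin s) (Fin s) ℝ) (lam : ℝ) : Prop :=
  ∀ z < 0, (symmPart (D z)).PosDef ∧ ∀ μ ∈ spectrum ℝ (symmPart (D z)), lam ≤ μ

/-- The stage difference `w^{i+1} - w^i`, where `w 0, …, w s` are the stage values of a step. -/
def stageDiff {M s : ℕ} (w : Fin (s + 1) → GridFn M) (i : Fin s) : GridFn M :=
  w i.succ - w i.castSucc

/-- The stage average `(w^{i+1} + w^i) / 2`. -/
def stageAvg {M s : ℕ} (w : Fin (s + 1) → GridFn M) (i : Fin s) : GridFn M :=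
  (1 / 2 : ℝ) • (w i.succ + w i.castSucc)

/-- The combination `∑_{j ≤ i} d_{ij}(τ M_h L_κ) (w^{j+1} - w^j)`. -/
def diffSum {s : ℕ} (L κ τ : ℝ) (M : ℕ) (md : Model) (D : ℝ → Matrix (Fin s) (Fin s) ℝ)
    (w : Fin (s + 1) → GridFn M) (i : Fin s) : GridFn M :=
  ∑ j ∈ Iic i, opFun L κ τ M md (fun z => D z i j) (stageDiff w j)

/-- `φ n` (time levels `n = 0, 1, …`) and `u n 0, …, u n s` (stage values of the step from `φ n` to
`φ (n + 1)`) are generated by the `s`-stage Runge-Kutta method in the differential form with the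
differentiation matrix `D`. -/
structure IsRKSolution {s : ℕ} (L ε κ τ : ℝ) (M : ℕ) (md : Model)
    (D : ℝ → Matrix (Fin s) (Fin s) ℝ)
    (φ : ℕ → GridFn M) (u : ℕ → Fin (s + 1) → GridFn M) : Prop where
  start : ∀ n, u n 0 = φ n
  next : ∀ n, φ (n + 1) = u n (Fin.last s)
  stage : ∀ n i, (1 / τ) • diffSum L κ τ M md D (u n) i =
    mobility L M md
      (stabOp L κ M (stageAvg (u n) i) - fun p => stabBulk ε κ (u n i.castSucc p))

/-- The dissipation `(1/τ) ∑_{i ≤ k} ⟨M_h⁻¹ δu^{i+1}, ∑_{j ≤ i} d_{ij}(τ M_h L_κ) δu^{j+1}⟩`. -/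
def dissipation {s : ℕ} (L κ τ : ℝ) (M : ℕ) (md : Model) (D : ℝ → Matrix (Fin s) (Fin s) ℝ)
    (w : Fin (s + 1) → GridFn M) (k : Fin s) : ℝ :=
  1 / τ * ∑ i ∈ Iic k, ip L M (mobilityInv L M md (stageDiff w i)) (diffSum L κ τ M md D w i)

end PFC

end

/-! Two mechanisms combine. First, the dissipation is nonpositive up to every stage `k`. In the
discrete Fourier basis all operators are diagonal, so on each mode it is a nonpositive number times
the quadratic form of `D z` tested on a vector truncated after index `k` (`dissipation_nonpos`).
Inserting the scheme cancels `M_h⁻¹` against `M_h` and turns the dissipation into the summed work of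
the stage residuals (`dissipation_eq`).

Second, for one stage from `v` to `w`, the energy of `v` plus this work is a predicted energy: the
exact quadratic part at `w` plus `F(v) + F'(v)(w - v) + κ/2 (w - v)²` (`energy_add_ip_residual`). It
majorizes the energy of `w` once `κ` beats the Taylor remainder, which needs sup bounds on `v` and
`w`. There is no circularity. Nonpositive dissipation keeps the predicted energy below `E₀`, and for
`κ ≥ 1` the predicted energy is coercive in `w` with constants free of `κ`. This bounds `w` in
discrete `H²`, hence in the sup norm by the mesh-independent embedding `exists_sup_bound`, before
any decrease is known, and so fixes the threshold for `κ` (`exists_stage_threshold`). Induction over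
stages and steps, with the coercivity of the energy, gives the rest. -/

noncomputable section

namespace PFC

/-! ### Orthogonality and completeness of the discrete exponentials. -/

/-- The additive character `n ↦ exp (2 π i n / M)`. -/
def rootChar (M : ℕ) (n : ℤ) : ℂ := Complex.exp (2 * Real.pi * Complex.I / M) ^ n

theorem rootChar_add (M : ℕ) (a b : ℤ) : rootChar M (a + b) = rootChar M a * rootChar M b :=
  zpow_add₀ (Complex.exp_ne_zero _) a b

theorem rootChar_eq_exp (M : ℕ) (n : ℤ) :
    rootChar M n = Complex.exp (Complex.I * (2 * Real.pi / M * n : ℝ)) := by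
  unfold rootChar
  rw [← Complex.exp_int_mul]
  congr 1
  push_cast
  ring

theorem conj_rootChar (M : ℕ) (n : ℤ) : (starRingEnd ℂ) (rootChar M n) = rootChar M (-n) := by
  rw [rootChar_eq_exp, rootChar_eq_exp, ← Complex.exp_conj]
  congr 1
  simp only [map_mul, Complex.conj_I, Complex.conj_ofReal]
  push_cast
  ring

theorem norm_rootChar (M : ℕ) (n : ℤ) : ‖rootChar M n‖ = 1 := by
  rw [rootChar_eq_exp, mul_comm, Complex.norm_exp_ofReal_mul_I]

theorem rootChar_eq_one_iff {M : ℕ} (hM : 0 < M) (n : ℤ) : rootChar M n = 1 ↔ (M : ℤ) ∣ n :=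
  (Complex.isPrimitiveRoot_exp M hM.ne').zpow_eq_one_iff_dvd n

theorem rootChar_congr {M : ℕ} (hM : 0 < M) {a b : ℤ} (h : (M : ℤ) ∣ a - b) :
    rootChar M a = rootChar M b := by
  have := rootChar_add M (a - b) b
  rwa [sub_add_cancel, (rootChar_eq_one_iff hM _).2 h, one_mul] at this

theorem rootChar_mul_natCast (M : ℕ) (a : ℤ) (x : ℕ) :
    rootChar M (a * x) = rootChar M a ^ x := by
  unfold rootChar
  rw [zpow_mul, zpow_natCast]

theorem sum_range_rootChar {M : ℕ} (hM : 0 < M) (a : ℤ) :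
    ∑ x ∈ range M, rootChar M (a * x) = if (M : ℤ) ∣ a then (M : ℂ) else 0 := by
  simp only [rootChar_mul_natCast]
  split_ifs with h
  · simp [(rootChar_eq_one_iff hM a).2 h]
  · have h1 : rootChar M a ≠ 1 := fun e => h ((rootChar_eq_one_iff hM a).1 e)
    rw [geom_sum_eq h1, ← rootChar_mul_natCast,
      (rootChar_eq_one_iff hM _).2 (dvd_mul_left _ _), sub_self, zero_div]

theorem sum_fin_rootChar {M : ℕ} (hM : 0 < M) (a : ℤ) :
    ∑ x : Fin M, rootChar M (a * (x : ℕ)) = if (M : ℤ) ∣ a then (M : ℂ) else 0 := by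
  rw [← sum_range_rootChar hM a, Finset.sum_range]

theorem sum_Ico_rootChar {M : ℕ} (hM : 0 < M) (hev : Even M) (a : ℤ) :
    ∑ k ∈ Ico (-((M : ℤ) / 2)) ((M : ℤ) / 2), rootChar M (k * a) =
      if (M : ℤ) ∣ a then (M : ℂ) else 0 := by
  obtain ⟨m, rfl⟩ := hev
  have hm : ((m + m : ℕ) : ℤ) / 2 = m := by omega
  -- The shift `k ↦ k + M/2` reduces to the geometric sum over `range M`, at the cost of a constant
  -- factor that is `1` when `M ∣ a`.
  have key : ∑ k ∈ Ico (-(m : ℤ)) (m : ℤ), rootChar (m + m) (k * a) =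
      ∑ x ∈ range (m + m), rootChar (m + m) (-(m : ℤ) * a) * rootChar (m + m) (a * x) := by
    refine Finset.sum_nbij' (fun k => (k + m).toNat) (fun x => (x : ℤ) - m) ?_ ?_ ?_ ?_ ?_
    · intro k hk; simp only [mem_Ico, mem_range] at *; omega
    · intro k hk; simp only [mem_Ico, mem_range] at *; omega
    · intro k hk; simp only [mem_Ico] at *; omega
    · intro k hk; simp
    · intro k hk
      simp only [mem_Ico] at hk
      rw [← rootChar_add, Int.toNat_of_nonneg (by omega)]
      congr 1; ring
  rw [hm, key, ← mul_sum, sum_range_rootChar hM]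
  split_ifs with h
  · rw [(rootChar_eq_one_iff hM _).2 (h.mul_left _), one_mul]
  · rw [mul_zero]

theorem expo_eq {L : ℝ} (hL : 0 < L) {M : ℕ} (k : ℤ × ℤ) (p : Fin M × Fin M) :
    expo L M k p = rootChar M (k.1 * (p.1 : ℕ)) * rootChar M (k.2 * (p.2 : ℕ)) := by
  rw [← rootChar_add, rootChar_eq_exp]
  unfold expo freq mesh
  congr 3
  have := hL.ne'
  push_cast
  field_simp

theorem norm_expo {L : ℝ} (hL : 0 < L) {M : ℕ} (k : ℤ × ℤ) (p : Fin M × Fin M) :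
    ‖expo L M k p‖ = 1 := by
  rw [expo_eq hL, norm_mul, norm_rootChar, norm_rootChar, one_mul]

theorem conj_expo {L : ℝ} (hL : 0 < L) {M : ℕ} (k : ℤ × ℤ) (p : Fin M × Fin M) :
    (starRingEnd ℂ) (expo L M k p) =
      rootChar M (-(k.1 * (p.1 : ℕ))) * rootChar M (-(k.2 * (p.2 : ℕ))) := by
  rw [expo_eq hL, map_mul, conj_rootChar, conj_rootChar]

theorem eq_of_dvd_sub_of_mem_Ico {M : ℕ} {a b : ℤ}
    (ha : a ∈ Ico (-((M : ℤ) / 2)) ((M : ℤ) / 2)) (hb : b ∈ Ico (-((M : ℤ) / 2)) ((M : ℤ) / 2))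
    (h : (M : ℤ) ∣ a - b) : a = b := by
  simp only [mem_Ico] at ha hb
  have := Int.eq_zero_of_abs_lt_dvd h (by rw [abs_lt]; omega)
  omega

/-- Orthogonality of the discrete exponentials over the grid. -/
theorem sum_expo_mul_conj {L : ℝ} (hL : 0 < L) {M : ℕ} (hM : 0 < M) {k l : ℤ × ℤ}
    (hk : k ∈ modes M) (hl : l ∈ modes M) :
    ∑ p, expo L M k p * (starRingEnd ℂ) (expo L M l p) = if k = l then (M : ℂ) ^ 2 else 0 := by
  have h1 : ∀ p : Fin M × Fin M, expo L M k p * (starRingEnd ℂ) (expo L M l p) =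
      rootChar M ((k.1 - l.1) * (p.1 : ℕ)) * rootChar M ((k.2 - l.2) * (p.2 : ℕ)) := by
    intro p
    rw [expo_eq hL, conj_expo hL, mul_mul_mul_comm, ← rootChar_add, ← rootChar_add]
    congr 2 <;> ring
  simp only [h1, Fintype.sum_prod_type, ← mul_sum, ← sum_mul, sum_fin_rootChar hM]
  unfold modes at hk hl
  rw [mem_product] at hk hl
  by_cases e : k = l
  · subst e; simp [sq]
  · rw [if_neg e]
    by_cases h1 : (M : ℤ) ∣ k.1 - l.1
    · have h2 : ¬ (M : ℤ) ∣ k.2 - l.2 := fun h2 => e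
        (Prod.ext (eq_of_dvd_sub_of_mem_Ico hk.1 hl.1 h1) (eq_of_dvd_sub_of_mem_Ico hk.2 hl.2 h2))
      rw [if_neg h2, mul_zero]
    · rw [if_neg h1, zero_mul]

theorem fin_eq_of_dvd {M : ℕ} {a b : Fin M} (h : (M : ℤ) ∣ ((a : ℕ) : ℤ) - (b : ℕ)) : a = b := by
  have := Int.eq_zero_of_abs_lt_dvd h (by rw [abs_lt]; omega)
  apply Fin.ext
  omega

/-- Completeness of the discrete exponentials. -/
theorem sum_modes_expo_mul_conj {L : ℝ} (hL : 0 < L) {M : ℕ} (hM : 0 < M) (hev : Even M)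
    (p q : Fin M × Fin M) :
    ∑ k ∈ modes M, expo L M k p * (starRingEnd ℂ) (expo L M k q) =
      if p = q then (M : ℂ) ^ 2 else 0 := by
  have h1 : ∀ k : ℤ × ℤ, expo L M k p * (starRingEnd ℂ) (expo L M k q) =
      rootChar M (k.1 * ((p.1 : ℕ) - (q.1 : ℕ))) *
        rootChar M (k.2 * ((p.2 : ℕ) - (q.2 : ℕ))) := by
    intro k
    rw [expo_eq hL, conj_expo hL, mul_mul_mul_comm, ← rootChar_add, ← rootChar_add]
    congr 2 <;> ring
  simp only [h1, modes, sum_product, ← mul_sum, ← sum_mul, sum_Ico_rootChar hM hev]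
  by_cases e : p = q
  · subst e; simp [sq]
  · rw [if_neg e]
    by_cases h1 : (M : ℤ) ∣ ((p.1 : ℕ) : ℤ) - (q.1 : ℕ)
    · have h2 : ¬ (M : ℤ) ∣ ((p.2 : ℕ) : ℤ) - (q.2 : ℕ) := fun h2 => e
        (Prod.ext (fin_eq_of_dvd h1) (fin_eq_of_dvd h2))
      rw [if_neg h2, mul_zero]
    · rw [if_neg h1, zero_mul]

/-! ### Fourier coefficients, inversion and Parseval. -/

theorem coeff_add (L : ℝ) (M : ℕ) (v w : GridFn M) (k : ℤ × ℤ) :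
    coeff L M (v + w) k = coeff L M v k + coeff L M w k := by
  simp [coeff, add_mul, sum_add_distrib, mul_add]

theorem coeff_smul (L : ℝ) (M : ℕ) (c : ℝ) (v : GridFn M) (k : ℤ × ℤ) :
    coeff L M (c • v) k = c * coeff L M v k := by
  simp only [coeff, Pi.smul_apply, smul_eq_mul, Complex.ofReal_mul, mul_assoc, ← mul_sum]
  ring

theorem coeff_sub (L : ℝ) (M : ℕ) (v w : GridFn M) (k : ℤ × ℤ) :
    coeff L M (v - w) k = coeff L M v k - coeff L M w k := by
  simp [coeff, sub_mul, sum_sub_distrib, mul_sub]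

theorem coeff_neg (L : ℝ) (M : ℕ) (v : GridFn M) (k : ℤ × ℤ) :
    coeff L M (-v) k = -coeff L M v k := by
  simp [coeff]

theorem coeff_sum {ι : Type*} (L : ℝ) (M : ℕ) (t : Finset ι) (v : ι → GridFn M) (k : ℤ × ℤ) :
    coeff L M (∑ i ∈ t, v i) k = ∑ i ∈ t, coeff L M (v i) k := by
  simp only [coeff, Finset.sum_apply, Complex.ofReal_sum, sum_mul, ← mul_sum]
  rw [sum_comm]

/-- The discrete Fourier inversion formula. -/
theorem sum_coeff_mul_expo {L : ℝ} (hL : 0 < L) {M : ℕ} (hM : 0 < M) (hev : Even M)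
    (v : GridFn M) (p : Fin M × Fin M) :
    ∑ k ∈ modes M, coeff L M v k * expo L M k p = v p := by
  have hM' : (M : ℂ) ≠ 0 := by exact_mod_cast hM.ne'
  have h1 : ∀ k, coeff L M v k * expo L M k p =
      ∑ q, 1 / (M : ℂ) ^ 2 * v q * (expo L M k p * (starRingEnd ℂ) (expo L M k q)) := by
    intro k
    rw [coeff, mul_sum, sum_mul]
    exact sum_congr rfl fun q _ => by ring
  simp only [h1]
  rw [sum_comm]
  simp only [← mul_sum, sum_modes_expo_mul_conj hL hM hev]
  simp
  field_simp

/-- Parseval's identity. -/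
theorem ip_eq_sum_coeff {L : ℝ} (hL : 0 < L) {M : ℕ} (hM : 0 < M) (hev : Even M)
    (v w : GridFn M) :
    ip L M v w =
      L ^ 2 * ∑ k ∈ modes M, (coeff L M v k * (starRingEnd ℂ) (coeff L M w k)).re := by
  have hM' : (M : ℂ) ≠ 0 := by exact_mod_cast hM.ne'
  have hMr : (M : ℝ) ≠ 0 := by exact_mod_cast hM.ne'
  have h1 : ∑ k ∈ modes M, coeff L M v k * (starRingEnd ℂ) (coeff L M w k) =
      ((1 / (M : ℝ) ^ 2 * ∑ p, v p * w p : ℝ) : ℂ) := by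
    have h2 : ∀ k, coeff L M v k * (starRingEnd ℂ) (coeff L M w k) =
        ∑ q, 1 / (M : ℂ) ^ 2 * w q * (coeff L M v k * expo L M k q) := by
      intro k
      conv_lhs => rw [coeff.eq_1 L M w]
      simp only [map_mul, map_sum, map_div₀, map_one, map_pow, Complex.conj_natCast,
        Complex.conj_ofReal, Complex.conj_conj, mul_sum]
      exact sum_congr rfl fun q _ => by ring
    simp only [h2]
    rw [sum_comm]
    simp only [← mul_sum, sum_coeff_mul_expo hL hM hev]
    push_cast
    rw [mul_sum]
    exact sum_congr rfl fun q _ => by ring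
  rw [← Complex.re_sum, h1, Complex.ofReal_re, ip, mesh]
  field_simp

/-! ### Real Fourier multipliers with even symbols. -/

/-- A symbol that depends only on the squares of the two wave numbers. -/
def IsEvenSymbol (σ : ℤ × ℤ → ℝ) : Prop :=
  ∀ k l : ℤ × ℤ, k.1 ^ 2 = l.1 ^ 2 → k.2 ^ 2 = l.2 ^ 2 → σ k = σ l

/-- The reflection `a ↦ -a` of the wave numbers modulo `M`, which fixes `-M/2`. -/
def reflect (M : ℕ) (a : ℤ) : ℤ := if a = -((M : ℤ) / 2) then a else -a

theorem reflect_mem {M : ℕ} {a : ℤ} (h : a ∈ Ico (-((M : ℤ) / 2)) ((M : ℤ) / 2)) :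
    reflect M a ∈ Ico (-((M : ℤ) / 2)) ((M : ℤ) / 2) := by
  unfold reflect
  simp only [mem_Ico] at *
  split_ifs <;> omega

theorem reflect_reflect {M : ℕ} {a : ℤ} (h : a ∈ Ico (-((M : ℤ) / 2)) ((M : ℤ) / 2)) :
    reflect M (reflect M a) = a := by
  unfold reflect
  simp only [mem_Ico] at *
  split_ifs <;> omega

theorem reflect_sq (M : ℕ) (a : ℤ) : reflect M a ^ 2 = a ^ 2 := by
  unfold reflect
  split_ifs <;> ring

/-- The unpaired frequency `-M/2` is harmless: it is congruent to its own negative modulo `M`. -/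
theorem rootChar_reflect {M : ℕ} (hM : 0 < M) (hev : Even M) (a : ℤ) (x : ℕ) :
    rootChar M (reflect M a * x) = rootChar M (-(a * x)) := by
  apply rootChar_congr hM
  unfold reflect
  split_ifs with h
  · have : a + a = -(M : ℤ) := by
      obtain ⟨m, rfl⟩ := hev
      omega
    exact ⟨-x, by linear_combination x * this⟩
  · exact ⟨0, by ring⟩

theorem expo_reflect {L : ℝ} (hL : 0 < L) {M : ℕ} (hM : 0 < M) (hev : Even M) (k : ℤ × ℤ)
    (p : Fin M × Fin M) :
    expo L M (reflect M k.1, reflect M k.2) p = (starRingEnd ℂ) (expo L M k p) := by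
  rw [conj_expo hL, expo_eq hL, rootChar_reflect hM hev, rootChar_reflect hM hev]

theorem coeff_reflect {L : ℝ} (hL : 0 < L) {M : ℕ} (hM : 0 < M) (hev : Even M) (v : GridFn M)
    (k : ℤ × ℤ) :
    coeff L M v (reflect M k.1, reflect M k.2) = (starRingEnd ℂ) (coeff L M v k) := by
  simp only [coeff, expo_reflect hL hM hev, map_mul, map_sum, map_div₀, map_one, map_pow,
    Complex.conj_natCast, Complex.conj_ofReal]

/-- Conjugation permutes the terms of the sum by reflecting the modes, so taking the real part in
`fourierMult` loses nothing. -/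
theorem ofReal_fourierMult {L : ℝ} (hL : 0 < L) {M : ℕ} (hM : 0 < M) (hev : Even M)
    {σ : ℤ × ℤ → ℝ} (hσ : IsEvenSymbol σ) (v : GridFn M) (p : Fin M × Fin M) :
    (fourierMult L M σ v p : ℂ) = ∑ k ∈ modes M, (σ k : ℂ) * coeff L M v k * expo L M k p := by
  unfold fourierMult
  rw [← Complex.conj_eq_iff_re, map_sum]
  refine Finset.sum_nbij' (fun k => (reflect M k.1, reflect M k.2))
    (fun k => (reflect M k.1, reflect M k.2)) ?_ ?_ ?_ ?_ ?_
  · intro k hk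
    rw [modes, mem_product] at *
    exact ⟨reflect_mem hk.1, reflect_mem hk.2⟩
  · intro k hk
    rw [modes, mem_product] at *
    exact ⟨reflect_mem hk.1, reflect_mem hk.2⟩
  · intro k hk
    rw [modes, mem_product] at hk
    exact Prod.ext (reflect_reflect hk.1) (reflect_reflect hk.2)
  · intro k hk
    rw [modes, mem_product] at hk
    exact Prod.ext (reflect_reflect hk.1) (reflect_reflect hk.2)
  · intro k _
    rw [expo_reflect hL hM hev, coeff_reflect hL hM hev,
      hσ (reflect M k.1, reflect M k.2) k (reflect_sq _ _) (reflect_sq _ _)]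
    simp only [map_mul, Complex.conj_ofReal]

theorem coeff_fourierMult {L : ℝ} (hL : 0 < L) {M : ℕ} (hM : 0 < M) (hev : Even M)
    {σ : ℤ × ℤ → ℝ} (hσ : IsEvenSymbol σ) (v : GridFn M) {k : ℤ × ℤ} (hk : k ∈ modes M) :
    coeff L M (fourierMult L M σ v) k = σ k * coeff L M v k := by
  have hM' : (M : ℂ) ≠ 0 := by exact_mod_cast hM.ne'
  rw [coeff]
  simp only [ofReal_fourierMult hL hM hev hσ, sum_mul]
  rw [sum_comm]
  have h1 : ∀ l ∈ modes M, ∑ p, (σ l : ℂ) * coeff L M v l * expo L M l p *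
      (starRingEnd ℂ) (expo L M k p) = if l = k then σ l * coeff L M v l * (M : ℂ) ^ 2 else 0 := by
    intro l hl
    simp only [mul_assoc, ← mul_sum]
    rw [sum_expo_mul_conj hL hM hl hk]
    split_ifs <;> simp
  rw [sum_congr rfl h1, sum_ite_eq' _ k, if_pos hk]
  field_simp

/-! ### Symbols of the operators of the scheme. -/

theorem isEvenSymbol_lapSymbol (L : ℝ) : IsEvenSymbol (lapSymbol L) := by
  intro k l h1 h2
  have h1' : (k.1 : ℝ) ^ 2 = (l.1 : ℝ) ^ 2 := by exact_mod_cast h1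
  have h2' : (k.2 : ℝ) ^ 2 = (l.2 : ℝ) ^ 2 := by exact_mod_cast h2
  simp only [lapSymbol, mul_pow, h1', h2']

theorem isEvenSymbol_lapSymbol_inv (L : ℝ) :
    IsEvenSymbol fun k => if k = 0 then 0 else (lapSymbol L k)⁻¹ := by
  intro k l h1 h2
  have h0 : k = 0 ↔ l = 0 := by
    rw [Prod.ext_iff, Prod.ext_iff, Prod.fst_zero, Prod.snd_zero, ← sq_eq_zero_iff (a := k.1),
      ← sq_eq_zero_iff (a := k.2), h1, h2, sq_eq_zero_iff, sq_eq_zero_iff]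
  simp only [h0, isEvenSymbol_lapSymbol L k l h1 h2]

theorem isEvenSymbol_mobility_mul_stab (L κ τ : ℝ) (md : Model) (g : ℝ → ℝ) :
    IsEvenSymbol fun k => g (τ * (mobilitySymbol L md k * stabSymbol L κ k)) := by
  intro k l h1 h2
  have h := isEvenSymbol_lapSymbol L k l h1 h2
  cases md <;> simp only [mobilitySymbol, stabSymbol, h]

theorem lapSymbol_neg {L : ℝ} (hL : 0 < L) {k : ℤ × ℤ} (hk : k ≠ 0) : lapSymbol L k < 0 := by
  have hf : freq L ≠ 0 := by unfold freq; positivity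
  have h : k.1 ≠ 0 ∨ k.2 ≠ 0 := by
    by_contra! h
    exact hk (Prod.ext h.1 h.2)
  unfold lapSymbol
  rcases h with h | h
  · have : (k.1 : ℝ) ≠ 0 := by exact_mod_cast h
    have : 0 < (freq L * k.1) ^ 2 := by positivity
    nlinarith [sq_nonneg (freq L * k.2)]
  · have : (k.2 : ℝ) ≠ 0 := by exact_mod_cast h
    have : 0 < (freq L * k.2) ^ 2 := by positivity
    nlinarith [sq_nonneg (freq L * k.1)]

theorem lapSymbol_zero (L : ℝ) : lapSymbol L 0 = 0 := by simp [lapSymbol]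

/-- The symbol of `M_h⁻¹`. -/
def mobilityInvSymbol (L : ℝ) : Model → ℤ × ℤ → ℝ
  | .swiftHohenberg, _ => -1
  | .phaseFieldCrystal, k => if k = 0 then 0 else (lapSymbol L k)⁻¹

theorem mobilityInvSymbol_nonpos {L : ℝ} (hL : 0 < L) (md : Model) (k : ℤ × ℤ) :
    mobilityInvSymbol L md k ≤ 0 := by
  cases md with
  | swiftHohenberg => simp [mobilityInvSymbol]
  | phaseFieldCrystal =>
    simp only [mobilityInvSymbol]
    split_ifs with h
    · exact le_rfl
    · exact (inv_lt_zero.2 (lapSymbol_neg hL h)).le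

theorem coeff_lap {L : ℝ} (hL : 0 < L) {M : ℕ} (hM : 0 < M) (hev : Even M) (v : GridFn M)
    {k : ℤ × ℤ} (hk : k ∈ modes M) : coeff L M (lap L M v) k = lapSymbol L k * coeff L M v k :=
  coeff_fourierMult hL hM hev (isEvenSymbol_lapSymbol L) v hk

theorem coeff_onePlusLap {L : ℝ} (hL : 0 < L) {M : ℕ} (hM : 0 < M) (hev : Even M) (v : GridFn M)
    {k : ℤ × ℤ} (hk : k ∈ modes M) :
    coeff L M (onePlusLap L M v) k = (1 + lapSymbol L k) * coeff L M v k := by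
  rw [onePlusLap, coeff_add, coeff_lap hL hM hev v hk]
  ring

theorem coeff_stabOp {L : ℝ} (hL : 0 < L) (κ : ℝ) {M : ℕ} (hM : 0 < M) (hev : Even M)
    (v : GridFn M) {k : ℤ × ℤ} (hk : k ∈ modes M) :
    coeff L M (stabOp L κ M v) k = stabSymbol L κ k * coeff L M v k := by
  rw [stabOp, coeff_add, coeff_smul, coeff_onePlusLap hL hM hev _ hk,
    coeff_onePlusLap hL hM hev _ hk, stabSymbol]
  push_cast
  ring

theorem coeff_mobility {L : ℝ} (hL : 0 < L) {M : ℕ} (hM : 0 < M) (hev : Even M) (md : Model)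
    (v : GridFn M) {k : ℤ × ℤ} (hk : k ∈ modes M) :
    coeff L M (mobility L M md v) k = mobilitySymbol L md k * coeff L M v k := by
  cases md with
  | swiftHohenberg => simp [mobility, mobilitySymbol, coeff_neg]
  | phaseFieldCrystal => exact coeff_lap hL hM hev v hk

theorem coeff_mobilityInv {L : ℝ} (hL : 0 < L) {M : ℕ} (hM : 0 < M) (hev : Even M) (md : Model)
    (v : GridFn M) {k : ℤ × ℤ} (hk : k ∈ modes M) :
    coeff L M (mobilityInv L M md v) k = mobilityInvSymbol L md k * coeff L M v k := by
  cases md with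
  | swiftHohenberg => simp [mobilityInv, mobilityInvSymbol, coeff_neg]
  | phaseFieldCrystal => exact coeff_fourierMult hL hM hev (isEvenSymbol_lapSymbol_inv L) v hk

theorem coeff_diffSum {s : ℕ} {L : ℝ} (hL : 0 < L) (κ τ : ℝ) {M : ℕ} (hM : 0 < M) (hev : Even M)
    (md : Model) (D : ℝ → Matrix (Fin s) (Fin s) ℝ) (w : Fin (s + 1) → GridFn M) (i : Fin s)
    {k : ℤ × ℤ} (hk : k ∈ modes M) :
    coeff L M (diffSum L κ τ M md D w i) k =
      ∑ j ∈ Iic i, (D (τ * (mobilitySymbol L md k * stabSymbol L κ k)) i j : ℂ) *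
        coeff L M (stageDiff w j) k := by
  rw [diffSum, coeff_sum]
  refine sum_congr rfl fun j _ => ?_
  exact coeff_fourierMult hL hM hev
    (isEvenSymbol_mobility_mul_stab L κ τ md fun z => D z i j) _ hk

/-! ### Inner product identities and summation by parts. -/

theorem ip_onePlusLap_left {L : ℝ} (hL : 0 < L) {M : ℕ} (hM : 0 < M) (hev : Even M)
    (v w : GridFn M) : ip L M (onePlusLap L M v) w = ip L M v (onePlusLap L M w) := by
  rw [ip_eq_sum_coeff hL hM hev, ip_eq_sum_coeff hL hM hev]
  congr 1
  refine sum_congr rfl fun k hk => ?_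
  rw [coeff_onePlusLap hL hM hev _ hk, coeff_onePlusLap hL hM hev _ hk]
  simp
  ring

theorem energy_eq {L : ℝ} (hL : 0 < L) (ε : ℝ) {M : ℕ} (hM : 0 < M) (hev : Even M)
    (v : GridFn M) :
    energy L ε M v = 1 / 2 * ip L M (onePlusLap L M v) (onePlusLap L M v) +
      ip L M (fun p => potential ε (v p)) 1 := by
  rw [energy, ip_onePlusLap_left hL hM hev]

theorem ip_sub_right (L : ℝ) (M : ℕ) (v w z : GridFn M) :
    ip L M v (w - z) = ip L M v w - ip L M v z := by
  simp [ip, mul_sub, sum_sub_distrib]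

theorem ip_smul_right (L : ℝ) (M : ℕ) (c : ℝ) (v w : GridFn M) :
    ip L M v (c • w) = c * ip L M v w := by
  simp only [ip, Pi.smul_apply, smul_eq_mul, mul_left_comm _ c, ← mul_sum]

theorem ip_self_nonneg (L : ℝ) (M : ℕ) (v : GridFn M) : 0 ≤ ip L M v v :=
  mul_nonneg (sq_nonneg _) (sum_nonneg fun _ _ => mul_self_nonneg _)

theorem ip_mono {L : ℝ} {M : ℕ} {v w : GridFn M} (h : ∀ p, v p ≤ w p) :
    ip L M v 1 ≤ ip L M w 1 := by
  unfold ip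
  gcongr with p
  · simp
  · exact h p

theorem ip_const (L : ℝ) {M : ℕ} (hM : 0 < M) (c : ℝ) : ip L M (fun _ => c) 1 = L ^ 2 * c := by
  have hM' : (M : ℝ) ≠ 0 := by exact_mod_cast hM.ne'
  simp [ip, mesh]
  field_simp

/-- For a self-adjoint operator the midpoint average makes the work an exact difference of quadratic
forms, with no remainder. -/
theorem ip_sub_stabOp_avg {L : ℝ} (hL : 0 < L) (κ : ℝ) {M : ℕ} (hM : 0 < M) (hev : Even M)
    (v w : GridFn M) :
    ip L M (w - v) (stabOp L κ M ((1 / 2 : ℝ) • (w + v))) =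
      1 / 2 * ip L M (onePlusLap L M w) (onePlusLap L M w) -
        1 / 2 * ip L M (onePlusLap L M v) (onePlusLap L M v) +
        κ / 2 * (ip L M w w - ip L M v v) := by
  simp only [ip_eq_sum_coeff hL hM hev]
  simp only [mul_left_comm _ (L ^ 2), ← mul_sub, ← mul_add]
  congr 1
  simp only [mul_sum, ← sum_sub_distrib, ← sum_add_distrib]
  refine sum_congr rfl fun k hk => ?_
  rw [coeff_stabOp hL κ hM hev _ hk, coeff_onePlusLap hL hM hev _ hk,
    coeff_onePlusLap hL hM hev _ hk, coeff_smul, coeff_add, coeff_sub, stabSymbol]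
  simp [pow_two]
  ring

theorem coeff_zero (L : ℝ) (M : ℕ) (v : GridFn M) :
    coeff L M v 0 = (1 / (M : ℂ) ^ 2) * ∑ p, (v p : ℂ) := by
  simp [coeff, expo]

theorem ip_one_eq_zero (L : ℝ) {M : ℕ} (hM : 0 < M) {v : GridFn M} (h : coeff L M v 0 = 0) :
    ip L M v 1 = 0 := by
  have hM' : (M : ℂ) ≠ 0 := by exact_mod_cast hM.ne'
  rw [coeff_zero, mul_eq_zero,
    or_iff_right (one_div_ne_zero (pow_ne_zero 2 hM'))] at h
  have : ∑ p, v p = 0 := by exact_mod_cast h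
  simp [ip, this]

theorem zero_mem_modes {M : ℕ} (hM : 0 < M) (hev : Even M) : (0 : ℤ × ℤ) ∈ modes M := by
  obtain ⟨m, rfl⟩ := hev
  simp only [modes, mem_product, mem_Ico, Prod.fst_zero, Prod.snd_zero]
  omega

/-! ### Triangular matrices and the sign of the dissipation. -/

/-- Forward substitution: invertibility makes every diagonal entry nonzero. -/
theorem eq_zero_of_sum_Iic_eq_zero {s : ℕ} {A : Matrix (Fin s) (Fin s) ℝ}
    (hA : ∀ i j, i < j → A i j = 0) (hu : IsUnit A) {x : Fin s → ℂ}
    (hx : ∀ i, ∑ j ∈ Iic i, (A i j : ℂ) * x j = 0) (i : Fin s) : x i = 0 := by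
  have hd : ∀ i, A i i ≠ 0 := by
    intro i
    have h := (Matrix.isUnit_iff_isUnit_det A).1 hu
    rw [Matrix.det_of_isLowerTriangular A (fun i j h => hA i j h), isUnit_iff_ne_zero,
      prod_ne_zero_iff] at h
    exact h i (mem_univ i)
  induction i using WellFoundedLT.induction with
  | ind i ih =>
    have h := hx i
    rw [← Iio_insert, sum_insert (by simp), sum_eq_zero (s := Iio i), add_zero, mul_eq_zero] at h
    · exact h.resolve_left (by exact_mod_cast hd i)
    · intro j hj
      rw [ih j (mem_Iio.1 hj), mul_zero]

/-- Setting the entries of `x` after `k` to zero gives a test vector for the full form, so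
positivity passes to each leading block; this is what makes the law stage-wise. -/
theorem sum_Iic_sum_Iic_nonneg {s : ℕ} {A : Matrix (Fin s) (Fin s) ℝ}
    (hA : ∀ i j, i < j → A i j = 0) (hp : (symmPart A).PosDef) (x : Fin s → ℝ) (k : Fin s) :
    0 ≤ ∑ i ∈ Iic k, ∑ j ∈ Iic i, A i j * x j * x i := by
  set y : Fin s → ℝ := fun i => if i ≤ k then x i else 0 with hy
  have h1 := (Matrix.posSemidef_iff_dotProduct_mulVec.1 hp.posSemidef).2 y
  have h2 : star y ⬝ᵥ (symmPart A).mulVec y = ∑ i, ∑ j, A i j * y j * y i := by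
    have h3 : ∑ i, ∑ j, A j i * y j * y i = ∑ i, ∑ j, A i j * y j * y i := by
      rw [sum_comm]
      exact sum_congr rfl fun i _ => sum_congr rfl fun j _ => by ring
    have h4 : star y ⬝ᵥ (symmPart A).mulVec y =
        1 / 2 * (∑ i, ∑ j, A i j * y j * y i + ∑ i, ∑ j, A j i * y j * y i) := by
      simp only [dotProduct, Matrix.mulVec, symmPart, mul_sum, ← sum_add_distrib]
      refine sum_congr rfl fun i _ => sum_congr rfl fun j _ => ?_
      simp
      ring
    rw [h4, h3]
    ring
  rw [h2] at h1
  have h5 : ∀ i, ∑ j, A i j * y j * y i = if i ≤ k then ∑ j ∈ Iic i, A i j * x j * x i else 0 := by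
    intro i
    split_ifs with hi
    · rw [← sum_subset (subset_univ (Iic i))]
      · refine sum_congr rfl fun j hj => ?_
        simp [hy, hi, (mem_Iic.1 hj).trans hi]
      · intro j _ hj
        rw [hA i j (by simpa using hj)]
        ring
    · simp [hy, hi]
  rw [sum_congr rfl fun i _ => h5 i, ← sum_filter] at h1
  have h6 : univ.filter (· ≤ k) = Iic k := by ext; simp
  rwa [h6] at h1

theorem stabSymbol_pos (L : ℝ) {κ : ℝ} (hκ : 0 < κ) (k : ℤ × ℤ) : 0 < stabSymbol L κ k := by
  unfold stabSymbol
  positivity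

/-- The dissipation is nonpositive when the differentiation matrices are positive definite. -/
theorem dissipation_nonpos {s : ℕ} {L κ τ : ℝ} (hL : 0 < L) (hκ : 0 < κ) (hτ : 0 < τ) {M : ℕ}
    (hM : 0 < M) (hev : Even M) (md : Model) {D : ℝ → Matrix (Fin s) (Fin s) ℝ}
    (hlow : IsLowerTriangular D) (hpos : ∀ z < 0, (symmPart (D z)).PosDef)
    (w : Fin (s + 1) → GridFn M) (k : Fin s) : dissipation L κ τ M md D w k ≤ 0 := by
  unfold dissipation
  refine mul_nonpos_of_nonneg_of_nonpos (by positivity) ?_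
  simp only [ip_eq_sum_coeff hL hM hev]
  rw [← mul_sum, sum_comm]
  refine mul_nonpos_of_nonneg_of_nonpos (by positivity) (sum_nonpos fun q hq => ?_)
  set z := τ * (mobilitySymbol L md q * stabSymbol L κ q) with hz
  set x := fun j => (coeff L M (stageDiff w j) q).re
  set y := fun j => (coeff L M (stageDiff w j) q).im
  have h1 : ∑ i ∈ Iic k, (coeff L M (mobilityInv L M md (stageDiff w i)) q *
      (starRingEnd ℂ) (coeff L M (diffSum L κ τ M md D w i) q)).re =
      mobilityInvSymbol L md q * (∑ i ∈ Iic k, ∑ j ∈ Iic i, D z i j * x j * x i +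
        ∑ i ∈ Iic k, ∑ j ∈ Iic i, D z i j * y j * y i) := by
    rw [← sum_add_distrib, mul_sum]
    refine sum_congr rfl fun i _ => ?_
    rw [coeff_mobilityInv hL hM hev md _ hq, coeff_diffSum hL κ τ hM hev md D w i hq,
      map_sum, mul_sum, Complex.re_sum, ← sum_add_distrib, mul_sum]
    refine sum_congr rfl fun j _ => ?_
    simp [x, y, ← hz]
    ring
  rw [h1]
  -- The mean mode of the phase field crystal model, where `z = 0` and positivity of `D z` is not
  -- assumed, drops out here.
  by_cases h0 : mobilityInvSymbol L md q = 0
  · rw [h0, zero_mul]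
  have hm : mobilitySymbol L md q < 0 := by
    cases md with
    | swiftHohenberg => simp [mobilitySymbol]
    | phaseFieldCrystal =>
      refine lapSymbol_neg hL fun e => h0 ?_
      simp [mobilityInvSymbol, e]
  have hz0 : z < 0 := by
    have := stabSymbol_pos L hκ q
    exact mul_neg_of_pos_of_neg hτ (mul_neg_of_neg_of_pos hm this)
  exact mul_nonpos_of_nonpos_of_nonneg (mobilityInvSymbol_nonpos hL md q)
    (add_nonneg (sum_Iic_sum_Iic_nonneg (hlow z hz0.le) (hpos z hz0) x k)
      (sum_Iic_sum_Iic_nonneg (hlow z hz0.le) (hpos z hz0) y k))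

/-! ### Dissipation as the work of the stage residuals. -/

/-- The residual `L_κ (w^{i+1} + w^i) / 2 - f_κ(w^i)` of the stage `i`. -/
def stageResidual {s M : ℕ} (L ε κ : ℝ) (w : Fin (s + 1) → GridFn M) (i : Fin s) : GridFn M :=
  stabOp L κ M (stageAvg w i) - fun p => stabBulk ε κ (w i.castSucc p)

/-- For the phase field crystal equation the stage differences have mean zero. -/
theorem coeff_stageDiff_zero {s : ℕ} {L ε κ τ : ℝ} (hL : 0 < L) (hτ : 0 < τ) {M : ℕ}
    (hM : 0 < M) (hev : Even M) {D : ℝ → Matrix (Fin s) (Fin s) ℝ}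
    (hlow : IsLowerTriangular D) (hu : IsUnit (D 0)) {w : Fin (s + 1) → GridFn M}
    (hw : ∀ i, (1 / τ) • diffSum L κ τ M .phaseFieldCrystal D w i =
      mobility L M .phaseFieldCrystal (stageResidual L ε κ w i)) (i : Fin s) :
    coeff L M (stageDiff w i) 0 = 0 := by
  refine eq_zero_of_sum_Iic_eq_zero (x := fun i => coeff L M (stageDiff w i) 0)
    (hlow 0 le_rfl) hu (fun i => ?_) i
  have h0 := zero_mem_modes hM hev
  -- On the mean mode the mobility vanishes, so `D 0` annihilates the vector of means.
  have h := congrArg (fun v => coeff L M v 0) (hw i)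
  simp only [coeff_smul, coeff_mobility hL hM hev _ _ h0, coeff_diffSum hL κ τ hM hev _ D w i h0,
    mobilitySymbol, lapSymbol_zero, zero_mul, mul_zero, Complex.ofReal_zero, mul_eq_zero] at h
  exact h.resolve_left (by exact_mod_cast (one_div_pos.2 hτ).ne')

/-- `M_h` is self-adjoint and cancels `M_h⁻¹` on every mode but the mean one, where the stage
difference itself vanishes. -/
theorem dissipation_eq {s : ℕ} {L ε κ τ : ℝ} (hL : 0 < L) {M : ℕ}
    (hM : 0 < M) (hev : Even M) {md : Model} {D : ℝ → Matrix (Fin s) (Fin s) ℝ}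
    {w : Fin (s + 1) → GridFn M}
    (hw : ∀ i, (1 / τ) • diffSum L κ τ M md D w i = mobility L M md (stageResidual L ε κ w i))
    (hmean : md = .phaseFieldCrystal → ∀ i, coeff L M (stageDiff w i) 0 = 0) (k : Fin s) :
    dissipation L κ τ M md D w k = ∑ i ∈ Iic k, ip L M (stageDiff w i) (stageResidual L ε κ w i) := by
  rw [dissipation, mul_sum]
  refine sum_congr rfl fun i _ => ?_
  rw [← ip_smul_right, hw, ip_eq_sum_coeff hL hM hev, ip_eq_sum_coeff hL hM hev]
  congr 1
  refine sum_congr rfl fun q hq => ?_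
  rw [coeff_mobilityInv hL hM hev md _ hq, coeff_mobility hL hM hev md _ hq]
  cases md with
  | swiftHohenberg => simp [mobilityInvSymbol, mobilitySymbol]
  | phaseFieldCrystal =>
    by_cases h0 : q = 0
    · subst h0
      simp [hmean rfl i]
    · have h1 : (lapSymbol L q : ℂ) ≠ 0 := by exact_mod_cast (lapSymbol_neg hL h0).ne
      simp only [mobilityInvSymbol, mobilitySymbol, if_neg h0, map_mul, Complex.conj_ofReal,
        Complex.ofReal_inv]
      congr 1
      field_simp

/-! ### The discrete Sobolev embedding. -/

theorem summable_one_div_one_add_sq {a : ℝ} (ha : 0 < a) :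
    Summable fun k : ℤ => 1 / (1 + (a * k) ^ 2) := by
  have h1 : Summable fun k : ℤ => 1 / a ^ 2 * (1 / (k : ℝ) ^ 2) + if k = 0 then 1 else 0 :=
    ((Real.summable_one_div_int_pow.2 one_lt_two).mul_left _).add (hasSum_ite_eq 0 1).summable
  refine Summable.of_nonneg_of_le (fun k => by positivity) (fun k => ?_) h1
  by_cases hk : k = 0
  · subst hk; simp
  · have : (k : ℝ) ≠ 0 := by exact_mod_cast hk
    have hpos : 0 < (a * k) ^ 2 := by positivity
    rw [if_neg hk, add_zero, one_div_mul_one_div, ← mul_pow]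
    exact one_div_le_one_div_of_le hpos (by linarith)

theorem sum_one_div_symbol_le {L : ℝ} (hL : 0 < L) (M : ℕ) :
    ∑ k ∈ modes M, 1 / (1 + (1 + lapSymbol L k) ^ 2) ≤
      8 * (∑' k : ℤ, 1 / (1 + (freq L * k) ^ 2)) ^ 2 := by
  have hf : 0 < freq L := by unfold freq; positivity
  -- With `a`, `b` the squared frequencies, `(1 + a)(1 + b) ≤ 8 (1 + (1 - a - b)²)`: the double sum
  -- splits into a product of convergent series independent of `M`.
  have h1 : ∀ k : ℤ × ℤ, 1 / (1 + (1 + lapSymbol L k) ^ 2) ≤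
      8 * (1 / (1 + (freq L * k.1) ^ 2) * (1 / (1 + (freq L * k.2) ^ 2))) := by
    intro k
    rw [one_div_mul_one_div, mul_one_div, div_le_div_iff₀ (by positivity) (by positivity),
      lapSymbol]
    nlinarith [sq_nonneg (1 - 3 * (freq L * k.1) ^ 2),
      mul_nonneg (sq_nonneg (freq L * k.1)) (sq_nonneg (freq L * k.2)),
      sq_nonneg (7 * ((freq L * k.1) ^ 2 + (freq L * k.2) ^ 2) - 9)]
  have hs := summable_one_div_one_add_sq hf
  have h2 := hs.sum_le_tsum (Ico (-((M : ℤ) / 2)) ((M : ℤ) / 2)) fun k _ => by positivity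
  refine (sum_le_sum fun k _ => h1 k).trans ?_
  rw [← mul_sum, modes, sum_product]
  simp only [← mul_sum, ← sum_mul]
  rw [sq]
  gcongr

/-- The discrete Sobolev embedding `H² ⊆ L^∞`, uniformly in the mesh size. -/
theorem exists_sup_bound {L : ℝ} (hL : 0 < L) :
    ∃ S : ℝ, 0 < S ∧ ∀ (M : ℕ), 0 < M → Even M → ∀ (v : GridFn M) (p : Fin M × Fin M),
      v p ^ 2 ≤ S * (ip L M (onePlusLap L M v) (onePlusLap L M v) + ip L M v v) := by
  set T := 8 * (∑' k : ℤ, 1 / (1 + (freq L * k) ^ 2)) ^ 2 with hT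
  have hT0 : 0 ≤ T := by positivity
  -- `T + 1` keeps the constant visibly positive; `L ^ 2` is the Parseval factor.
  refine ⟨(T + 1) / L ^ 2, by positivity, fun M hM hev v p => ?_⟩
  have h1 : |v p| ≤ ∑ k ∈ modes M, ‖coeff L M v k‖ := by
    rw [← Real.norm_eq_abs, ← Complex.norm_real, ← sum_coeff_mul_expo hL hM hev v p]
    refine (norm_sum_le _ _).trans (sum_le_sum fun k _ => ?_)
    rw [norm_mul, norm_expo hL, mul_one]
  -- Cauchy–Schwarz with the `H²` weight.
  have h2 : (∑ k ∈ modes M, ‖coeff L M v k‖) ^ 2 ≤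
      (∑ k ∈ modes M, 1 / (1 + (1 + lapSymbol L k) ^ 2)) *
        ∑ k ∈ modes M, (1 + (1 + lapSymbol L k) ^ 2) * ‖coeff L M v k‖ ^ 2 := by
    refine sum_sq_le_sum_mul_sum_of_sq_le_mul _ (fun k _ => by positivity)
      (fun k _ => by positivity) (fun k _ => ?_)
    have : (1 + (1 + lapSymbol L k) ^ 2) ≠ 0 := by positivity
    rw [← mul_assoc, one_div_mul_cancel this, one_mul]
  have h3 : ip L M (onePlusLap L M v) (onePlusLap L M v) + ip L M v v =
      L ^ 2 * ∑ k ∈ modes M, (1 + (1 + lapSymbol L k) ^ 2) * ‖coeff L M v k‖ ^ 2 := by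
    rw [ip_eq_sum_coeff hL hM hev, ip_eq_sum_coeff hL hM hev, ← mul_add, ← sum_add_distrib]
    congr 1
    refine sum_congr rfl fun k hk => ?_
    rw [coeff_onePlusLap hL hM hev _ hk, ← Complex.normSq_eq_norm_sq, Complex.normSq_apply]
    simp
    ring
  have h4 : 0 ≤ ∑ k ∈ modes M, (1 + (1 + lapSymbol L k) ^ 2) * ‖coeff L M v k‖ ^ 2 :=
    sum_nonneg fun k _ => by positivity
  rw [h3, ← mul_assoc, div_mul_cancel₀ _ (by positivity), ← sq_abs]
  calc |v p| ^ 2 ≤ (∑ k ∈ modes M, ‖coeff L M v k‖) ^ 2 := by gcongr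
    _ ≤ _ := h2
    _ ≤ _ := by
      gcongr
      linarith [sum_one_div_symbol_le hL M]

/-! ### Coercivity of the energy and the decrease over one stage. -/

/-- The energy controls the discrete `H²` norm. -/
theorem two_mul_norms_le_energy {L : ℝ} (hL : 0 < L) (ε : ℝ) {M : ℕ} (hM : 0 < M)
    (hev : Even M) (v : GridFn M) :
    2 * ip L M (onePlusLap L M v) (onePlusLap L M v) + 2 * ip L M v v ≤
      4 * energy L ε M v + (1 + ε) ^ 2 * L ^ 2 := by
  have h1 : ip L M (fun p => 2 * v p ^ 2 - 4 * potential ε (v p)) 1 ≤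
      ip L M (fun _ => (1 + ε) ^ 2) 1 :=
    ip_mono fun p => by
      unfold potential
      -- Completing the square: `2x² - 4F(x) = (1 + ε)² - (x² - (1 + ε))²`.
      nlinarith [sq_nonneg (v p ^ 2 - (1 + ε))]
  have h2 : ip L M (fun p => 2 * v p ^ 2 - 4 * potential ε (v p)) 1 =
      2 * ip L M v v - 4 * ip L M (fun p => potential ε (v p)) 1 := by
    simp only [ip, Pi.one_apply, mul_one, sum_sub_distrib, ← mul_sum, ← sq]
    ring
  rw [ip_const L hM, h2] at h1
  rw [energy_eq hL ε hM hev]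
  linarith

theorem l2norm_add_l2norm_le {L : ℝ} (hL : 0 < L) (ε : ℝ) {M : ℕ} (hM : 0 < M)
    (hev : Even M) (v : GridFn M) :
    l2norm L M (onePlusLap L M v) + l2norm L M v ≤
      Real.sqrt (4 * energy L ε M v + (1 + ε) ^ 2 * L ^ 2) := by
  apply Real.le_sqrt_of_sq_le
  refine le_trans ?_ (two_mul_norms_le_energy hL ε hM hev v)
  have h1 := Real.sq_sqrt (ip_self_nonneg L M (onePlusLap L M v))
  have h2 := Real.sq_sqrt (ip_self_nonneg L M v)
  unfold l2norm
  nlinarith [sq_nonneg (Real.sqrt (ip L M (onePlusLap L M v) (onePlusLap L M v)) -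
    Real.sqrt (ip L M v v))]

/-- The work of the stage residual, with the linear part summed by parts. -/
theorem energy_add_ip_residual {L : ℝ} (hL : 0 < L) (ε κ : ℝ) {M : ℕ} (hM : 0 < M)
    (hev : Even M) (v w : GridFn M) :
    energy L ε M v + ip L M (w - v) (stabOp L κ M ((1 / 2 : ℝ) • (w + v)) -
        fun p => stabBulk ε κ (v p)) =
      1 / 2 * ip L M (onePlusLap L M w) (onePlusLap L M w) +
        ip L M (fun p => potential ε (v p) + κ / 2 * (w p - v p) ^ 2 -
          (w p - v p) * bulk ε (v p)) 1 := by
  rw [ip_sub_right, ip_sub_stabOp_avg hL κ hM hev, energy_eq hL ε hM hev]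
  have h : κ / 2 * (ip L M w w - ip L M v v) - ip L M (w - v) (fun p => stabBulk ε κ (v p)) +
      ip L M (fun p => potential ε (v p)) 1 =
      ip L M (fun p => potential ε (v p) + κ / 2 * (w p - v p) ^ 2 -
          (w p - v p) * bulk ε (v p)) 1 := by
    simp only [ip, ← mul_sub, ← mul_add, mul_left_comm _ (mesh L M ^ 2)]
    congr 1
    simp only [mul_sum, ← sum_sub_distrib, ← sum_add_distrib]
    refine sum_congr rfl fun p _ => ?_
    simp [stabBulk]
    ring
  linarith

/-- The exact Taylor remainder of `F` is `(y - x)² (y² + 2xy + 3x² - 2ε) / 4`, and `y² + 2xy + 3x² ≤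
2y² + 4x² ≤ 6B`. -/
theorem potential_le {ε κ B x y : ℝ} (hε : 0 < ε) (hx : x ^ 2 ≤ B) (hy : y ^ 2 ≤ B)
    (hκ : 3 * B ≤ κ) :
    potential ε y ≤ potential ε x + κ / 2 * (y - x) ^ 2 - (y - x) * bulk ε x := by
  have h1 : y ^ 2 + 2 * x * y + 3 * x ^ 2 - 2 * ε ≤ 2 * κ := by
    nlinarith [sq_nonneg (x - y)]
  have h2 := mul_le_mul_of_nonneg_left h1 (sq_nonneg (y - x))
  unfold potential bulk
  linarith

/-- Coercivity of the predicted energy in the increment `d`. Using only `κ ≥ 1` keeps the constant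
free of `κ`, so the threshold built from it is not self-referential. -/
theorem potential_add_ge {ε κ B x d : ℝ} (hε₀ : 0 < ε) (hε₁ : ε < 1) (hκ : 1 ≤ κ)
    (hx : x ^ 2 ≤ B) :
    d ^ 2 / 4 - (1 / 4 + B * (1 + B) ^ 2) ≤ potential ε x + κ / 2 * d ^ 2 - d * bulk ε x := by
  have hB : 0 ≤ B := (sq_nonneg x).trans hx
  have h1 : -(1 / 4) ≤ potential ε x := by
    unfold potential
    nlinarith [sq_nonneg (x ^ 2 - ε)]
  have h2 : bulk ε x ^ 2 ≤ B * (1 + B) ^ 2 := by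
    have e : bulk ε x ^ 2 = x ^ 2 * (ε - x ^ 2) ^ 2 := by unfold bulk; ring
    have h3 : (ε - x ^ 2) ^ 2 ≤ (1 + B) ^ 2 := by
      apply sq_le_sq'
      · linarith
      · linarith [sq_nonneg x]
    rw [e]
    gcongr
  have h4 : 0 ≤ (κ - 1) * d ^ 2 := mul_nonneg (by linarith) (sq_nonneg d)
  nlinarith [sq_nonneg (d / 2 - bulk ε x)]

/-- For a stabilization parameter above a threshold depending only on the energy bound, one stage
whose predicted energy stays below the bound decreases the energy by the predicted amount. -/
theorem exists_stage_threshold {L ε : ℝ} (hL : 0 < L) (hε₀ : 0 < ε) (hε₁ : ε < 1) (E₀ : ℝ) :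
    ∃ Cf : ℝ, 0 < Cf ∧ ∀ κ, Cf ≤ κ → ∀ M : ℕ, 0 < M → Even M → ∀ v w : GridFn M,
      energy L ε M v ≤ E₀ →
      energy L ε M v + ip L M (w - v) (stabOp L κ M ((1 / 2 : ℝ) • (w + v)) -
        fun p => stabBulk ε κ (v p)) ≤ E₀ →
      energy L ε M w ≤ energy L ε M v +
        ip L M (w - v) (stabOp L κ M ((1 / 2 : ℝ) • (w + v)) - fun p => stabBulk ε κ (v p)) := by
  obtain ⟨S, hS, hsup⟩ := exists_sup_bound hL
  -- `B` bounds `v²` pointwise. `K` bounds `½‖(I + Δ_h)w‖² + ¼‖w - v‖²` through the predicted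
  -- energy. Then `‖(I + Δ_h)w‖² ≤ 2K` and `‖w‖² ≤ 2‖w - v‖² + 2‖v‖² ≤ 8K + 2L²B`, which gives the
  -- pointwise bound `B'` for `w²`.
  set B := S * (2 * E₀ + (1 + ε) ^ 2 * L ^ 2 / 2) with hB
  set K := E₀ + L ^ 2 * (1 / 4 + B * (1 + B) ^ 2) with hK
  set B' := S * (2 * K + (8 * K + L ^ 2 * (2 * B))) with hB'
  refine ⟨max 1 (3 * max B B'), by positivity, fun κ hκ M hM hev v w hv hw => ?_⟩
  have hκ1 : 1 ≤ κ := (le_max_left _ _).trans hκ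
  have hκB : 3 * max B B' ≤ κ := (le_max_right _ _).trans hκ
  rw [energy_add_ip_residual hL ε κ hM hev] at hw ⊢
  have hvB : ∀ p, v p ^ 2 ≤ B := fun p => by
    refine (hsup M hM hev v p).trans ?_
    rw [hB]
    refine mul_le_mul_of_nonneg_left ?_ hS.le
    linarith [two_mul_norms_le_energy hL ε hM hev v]
  have h1 : ip L M (fun p => (w p - v p) ^ 2 / 4 - (1 / 4 + B * (1 + B) ^ 2)) 1 ≤
      ip L M (fun p => potential ε (v p) + κ / 2 * (w p - v p) ^ 2 -
          (w p - v p) * bulk ε (v p)) 1 :=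
    ip_mono fun p => potential_add_ge hε₀ hε₁ hκ1 (hvB p)
  have h2 : ip L M (fun p => (w p - v p) ^ 2 / 4 - (1 / 4 + B * (1 + B) ^ 2)) 1 =
      ip L M (w - v) (w - v) / 4 - L ^ 2 * (1 / 4 + B * (1 + B) ^ 2) := by
    rw [← ip_const L hM]
    simp only [ip, Pi.one_apply, mul_one, sum_sub_distrib, ← sum_div, Pi.sub_apply, ← sq]
    ring
  have h3 : ip L M v v ≤ L ^ 2 * B := by
    rw [← ip_const L hM]
    have : ip L M v v = ip L M (fun p => v p ^ 2) 1 := by simp [ip, sq]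
    rw [this]
    exact ip_mono hvB
  have h4 : ip L M w w ≤ 2 * ip L M (w - v) (w - v) + 2 * ip L M v v := by
    simp only [ip, mul_left_comm _ (mesh L M ^ 2), ← mul_add]
    gcongr
    simp only [mul_sum, ← sum_add_distrib]
    refine sum_le_sum fun p _ => ?_
    simp only [Pi.sub_apply]
    nlinarith [sq_nonneg (w p - 2 * v p)]
  have h5 := ip_self_nonneg L M (onePlusLap L M w)
  have h6 := ip_self_nonneg L M (w - v)
  have hwB : ∀ p, w p ^ 2 ≤ B' := fun p => by
    refine (hsup M hM hev w p).trans ?_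
    rw [hB']
    gcongr <;> linarith
  rw [energy_eq hL ε hM hev]
  gcongr
  exact ip_mono fun p => potential_le hε₀ ((hvB p).trans (le_max_left _ _))
    ((hwB p).trans (le_max_right _ _)) hκB

end PFC

end

/-! ### Induction over stages and time steps. -/

theorem theorem1 (L ε E₀ : ℝ) (hL : 0 < L) (hε₀ : 0 < ε) (hε₁ : ε < 1) :
    ∃ Cf : ℝ, 0 < Cf ∧ ∀ (s : ℕ) (lam κ : ℝ), 0 < lam → Cf ≤ κ →
      ∃ τ₀ : ℝ, 0 < τ₀ ∧
        ∀ (md : PFC.Model) (D : ℝ → Matrix (Fin s) (Fin s) ℝ),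
          PFC.IsLowerTriangular D → PFC.UniformlyPosDef D lam →
          (md = PFC.Model.phaseFieldCrystal → IsUnit (D 0)) →
        ∀ (M : ℕ) (τ : ℝ), 0 < M → Even M → 0 < τ → τ ≤ τ₀ →
        ∀ (φ : ℕ → PFC.GridFn M) (u : ℕ → Fin (s + 1) → PFC.GridFn M),
          PFC.IsRKSolution L ε κ τ M md D φ u → PFC.energy L ε M (φ 0) ≤ E₀ →
          ∀ n : ℕ,
            (md = PFC.Model.phaseFieldCrystal →
              ∀ i : Fin s, PFC.ip L M (PFC.stageDiff (u n) i) 1 = 0) ∧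
            (∀ k : Fin s,
              PFC.energy L ε M (u n k.succ) - PFC.energy L ε M (u n 0) ≤
                PFC.dissipation L κ τ M md D (u n) k ∧
              PFC.dissipation L κ τ M md D (u n) k ≤ 0) ∧
            (∀ i : Fin (s + 1),
              PFC.l2norm L M (PFC.onePlusLap L M (u n i)) + PFC.l2norm L M (u n i) ≤
                Real.sqrt (4 * PFC.energy L ε M (φ 0) + (1 + ε) ^ 2 * L ^ 2)) := by
  obtain ⟨Cf, hCf, hstage⟩ := PFC.exists_stage_threshold hL hε₀ hε₁ E₀
  -- The stage estimate is uniform in `τ`, so any positive `τ₀` serves.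
  refine ⟨Cf, hCf, fun s lam κ _ hκ => ⟨1, one_pos, ?_⟩⟩
  intro md D hlow hpos hunit M τ hM hev hτ _ φ u hsol hE
  have hmean : ∀ n, md = PFC.Model.phaseFieldCrystal →
      ∀ i, PFC.coeff L M (PFC.stageDiff (u n) i) 0 = 0 := by
    intro n hmd i
    have hu := hunit hmd
    subst hmd
    exact PFC.coeff_stageDiff_zero hL hτ hM hev hlow hu (hsol.stage n) i
  have hdiss : ∀ n k, PFC.dissipation L κ τ M md D (u n) k ≤ 0 := fun n k =>
    PFC.dissipation_nonpos hL (hCf.trans_le hκ) hτ hM hev md hlow (fun z hz => (hpos z hz).1) _ k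
  have hlaw : ∀ n, PFC.energy L ε M (u n 0) ≤ E₀ → ∀ k : Fin s,
      PFC.energy L ε M (u n k.succ) - PFC.energy L ε M (u n 0) ≤
        PFC.dissipation L κ τ M md D (u n) k := by
    intro n hn k
    have heq := PFC.dissipation_eq (ε := ε) hL hM hev (hsol.stage n) (hmean n)
    induction k using WellFoundedLT.induction with
    | ind k ih =>
      set r : Fin s → ℝ := fun i =>
        PFC.ip L M (PFC.stageDiff (u n) i) (PFC.stageResidual L ε κ (u n) i) with hr
      -- The law up to the preceding stage; for the first stage the sum is empty.
      have h1 : PFC.energy L ε M (u n k.castSucc) - PFC.energy L ε M (u n 0) ≤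
          ∑ i ∈ Iio k, r i ∧ ∑ i ∈ Iio k, r i ≤ 0 := by
        rcases k with ⟨k, hk⟩
        cases k with
        | zero =>
          have h0 : Iio (⟨0, hk⟩ : Fin s) = ∅ := by
            ext x; simp [Fin.lt_def]
          rw [h0]
          simp
        | succ j =>
          have h0 : Iio (⟨j + 1, hk⟩ : Fin s) = Iic ⟨j, by omega⟩ := by
            ext x; simp [Fin.lt_def, Fin.le_def]
          rw [h0, ← heq]
          exact ⟨ih ⟨j, by omega⟩ (by simp [Fin.lt_def]), hdiss n _⟩
      have h2 : PFC.dissipation L κ τ M md D (u n) k = r k + ∑ i ∈ Iio k, r i := by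
        rw [heq, ← Iio_insert, sum_insert (by simp)]
      have h3 := hdiss n k
      -- The predicted energy is at most the initial energy of the step plus the dissipation up to
      -- `k`, hence at most `E₀`.
      have h4 := hstage κ hκ M hM hev (u n k.castSucc) (u n k.succ) (by linarith)
        (show _ + r k ≤ E₀ by linarith)
      change _ ≤ _ + r k at h4
      linarith
  have hstep : ∀ n, PFC.energy L ε M (u n 0) ≤ E₀ → ∀ i,
      PFC.energy L ε M (u n i) ≤ PFC.energy L ε M (u n 0) := by
    intro n hn i
    refine Fin.cases le_rfl (fun k => ?_) i
    linarith [hlaw n hn k, hdiss n k]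
  have hall : ∀ n, PFC.energy L ε M (u n 0) ≤ PFC.energy L ε M (φ 0) := by
    intro n
    induction n with
    | zero => rw [hsol.start]
    | succ n ih =>
      rw [hsol.start, hsol.next]
      exact (hstep n (ih.trans hE) _).trans ih
  intro n
  refine ⟨fun hmd i => PFC.ip_one_eq_zero L hM (hmean n hmd i),
    fun k => ⟨hlaw n ((hall n).trans hE) k, hdiss n k⟩, fun i => ?_⟩
  refine (PFC.l2norm_add_l2norm_le hL ε hM hev _).trans (Real.sqrt_le_sqrt ?_)
  linarith [hstep n ((hall n).trans hE) i, hall n]
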